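/- Let $k$ be a field, let $n\ge 2$ and $r\ge 3n+2$ be integers, and put $s=r(3n+2)+3$. Let $\mathfrak P_{nr}\subset S=k[x_1,x_2,x_3,x_4]$ be the defining ideal of the Backelin monomial curve $B_{nr}=C(s,\,s+3,\,s+3n+1,\,s+3n+2)$, i.e. the kernel of the $k$-algebra map $S\to k[t]$ with $x_1\mapsto t^{s}$, $x_2\mapsto t^{s+3}$, $x_3\mapsto t^{s+3n+1}$, $x_4\mapsto t^{s+3n+2}$. Let $\mathrm{in}_<(\mathfrak P_{nr})$ be its initial ideal for the degree reverse lexicographic order with $x_1>x_2>x_3>x_4$. The ideal $\mathfrak P_{nr}$ is not homogeneous for the standard grading; the Hilbert function of $S/\mathfrak P_{nr}$ is taken with respect to total degree, $H(S/\mathfrak P_{nr},i)=\dim_k F_i/F_{i-1}$, where $F_i$ is the image in $S/\mathfrak P_{nr}$ of the polynomials of total degree at most $i$ and $F_{-1}=0$. The Hilbert function of $S/\mathrm{in}_<(\mathfrak P_{nr})$ is the usual one, $H(S/\mathrm{in}_<(\mathfrak P_{nr}),i)=\dim_k (S/\mathrm{in}_<(\mathfrak P_{nr}))_i$. Then $$\sum_{i\ge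 0}H(S/\mathfrak P_{nr},i)\,t^i=\sum_{i\ge 0}H(S/\mathrm{in}_<(\mathfrak P_{nr}),i)\,t^i=\frac{p(t)}{(1-t)^4},$$ where the numerator is $$\begin{aligned}p(t)={}&1-nt^{r+2}-2t^{r+3}+(3n+4)t^{r+4}-(2n+2)t^{r+5}-t^{2n+3}+2t^{2n+2}-t^{2n+1}\\&+t^{n+4}+t^{n+3}-t^{n+2}-t^{n+1}-t^{4}-\sum_{i=2}^{n}\left(t^{n+2i-1}+t^{n+2i+1}-2t^{n+2i}\right).\end{aligned}$$ -/

import Mathlib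

namespace BackelinCurve

/-- The defining ideal of the monomial curve with exponents `a`: the kernel of the `k`-algebra map
`k[x_0, …, x_{m-1}] → k[t]`, `x_i ↦ t ^ a i`. -/
noncomputable def monomialCurveIdeal (k : Type*) [Field k] {m : ℕ} (a : Fin m → ℕ) :
    Ideal (MvPolynomial (Fin m) k) :=
  RingHom.ker (MvPolynomial.aeval (fun i => (Polynomial.X : Polynomial k) ^ a i) :
    MvPolynomial (Fin m) k →ₐ[k] Polynomial k)

/-- The parameter `s = r (3n + 2) + 3` of the Backelin semigroups. -/
def backelinS (n r : ℕ) : ℕ := r * (3 * n + 2) + 3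

/-- The defining ideal `𝔓_{nr}` of the Backelin curve `C(s, s+3, s+3n+1, s+3n+2)`.
The variables `x_1, x_2, x_3, x_4` are indexed by `0, 1, 2, 3 : Fin 4`. -/
noncomputable def backelinIdeal (k : Type*) [Field k] (n r : ℕ) :
    Ideal (MvPolynomial (Fin 4) k) :=
  monomialCurveIdeal k ![backelinS n r, backelinS n r + 3,
    backelinS n r + 3 * n + 1, backelinS n r + 3 * n + 2]

section HilbertFunction

variable {k : Type*} [Field k] {m : ℕ}

/-- The image in `S/I` (`S = k[x_0, …, x_{m-1}]`) of the `k`-span of the monomials whose exponent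
lies in `D`. -/
noncomputable def imageSpan (I : Ideal (MvPolynomial (Fin m) k)) (D : Set (Fin m →₀ ℕ)) :
    Submodule k (MvPolynomial (Fin m) k ⧸ I) :=
  (MvPolynomial.restrictSupport k D).map (Ideal.Quotient.mkₐ k I).toLinearMap

/-- The (standard) Hilbert function of the graded ring `S/J` for a homogeneous ideal `J`:
`i ↦ dim_k (S/J)_i`, where `(S/J)_i` is the image of the forms of degree `i`. -/
noncomputable def gradedHilbertFunction (J : Ideal (MvPolynomial (Fin m) k)) (i : ℕ) : ℕ :=
  Module.finrank k
    ((MvPolynomial.homogeneousSubmodule (Fin m) k i).map (Ideal.Quotient.mkₐ k J).toLinearMap)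

/-- The Hilbert function of `S/I` for an arbitrary ideal `I`, with respect to total degree:
`i ↦ dim_k (F_i / F_{i-1})`, where `F_i` is the image in `S/I` of the polynomials of
total degree at most `i` (and `F_{-1} = 0`). -/
noncomputable def hilbertFunction (I : Ideal (MvPolynomial (Fin m) k)) (i : ℕ) : ℕ :=
  Module.finrank k
    (imageSpan I {d | d.degree ≤ i} ⧸
      (imageSpan I {d | d.degree < i}).submoduleOf (imageSpan I {d | d.degree ≤ i}))

/-- The strict degree reverse lexicographic order on exponents, for `x_0 > x_1 > ⋯ > x_{m-1}`:
`x^d < x^e` if `|d| < |e|`, or `|d| = |e|` and `e_i < d_i` at the last index `i`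
where `d` and `e` differ. -/
def DegRevLexLT (d e : Fin m →₀ ℕ) : Prop :=
  d.degree < e.degree ∨
    (d.degree = e.degree ∧ ∃ i, e i < d i ∧ ∀ j, i < j → d j = e j)

/-- `x^d` is the leading monomial of `f` for the degree reverse lexicographic order. -/
def IsLeadingExponent (f : MvPolynomial (Fin m) k) (d : Fin m →₀ ℕ) : Prop :=
  d ∈ f.support ∧ ∀ e ∈ f.support, e ≠ d → DegRevLexLT e d

/-- The initial ideal of `I` for the degree reverse lexicographic order. -/
noncomputable def initialIdeal (I : Ideal (MvPolynomial (Fin m) k)) :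
    Ideal (MvPolynomial (Fin m) k) :=
  Ideal.span {g | ∃ f ∈ I, ∃ d, IsLeadingExponent f d ∧ g = MvPolynomial.monomial d 1}

end HilbertFunction

/-- The generating series `∑ h(i) t^i` of `h : ℕ → ℕ`, as an integer power series. -/
noncomputable def series (h : ℕ → ℕ) : PowerSeries ℤ := PowerSeries.mk fun i => (h i : ℤ)

open Polynomial in
/-- The polynomial `p(t)` in the formula for the Hilbert series of the Backelin curve. -/
noncomputable def backelinNumerator (n r : ℕ) : Polynomial ℤ :=
  1 - (n : ℤ[X]) * X ^ (r + 2) - 2 * X ^ (r + 3) + (3 * (n : ℤ[X]) + 4) * X ^ (r + 4)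
    - (2 * (n : ℤ[X]) + 2) * X ^ (r + 5)
    - X ^ (2 * n + 3) + 2 * X ^ (2 * n + 2) - X ^ (2 * n + 1)
    + X ^ (n + 4) + X ^ (n + 3) - X ^ (n + 2) - X ^ (n + 1) - X ^ 4
    - ∑ i ∈ Finset.Icc 2 n,
        (X ^ (n + 2 * i - 1) + X ^ (n + 2 * i + 1) - 2 * X ^ (n + 2 * i))

end BackelinCurve

/-!
Since the order refines the degree, the monomials of degree at most `i` outside `in(I)` form a
basis of `F_i` and also of the part of degree at most `i` of `S / in(I)`. This is Macaulay's
theorem, and it makes the two Hilbert functions equal for every ideal.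

For a monomial curve, `dim F_i` counts the elements of the semigroup that are sums of at most `i`
generators. For the generators `s + τ` with `τ ∈ {0, 3, 3n+1, 3n+2}`, the sums of exactly `i`
generators are the numbers `s i + x` with `x` in the `i`-fold sumset `A_i` of the offsets, so
`H(S/I, i)` is the size of `A_i` minus the number of `x` that drop, that is, for which `s i + x` is
also a sum of fewer generators.

* The sumset `A_i` is counted by exponent triples in normal form, with respect to a Gröbner basis
  of the curve `C(3, 3n+1, 3n+2)` whose reductions do not increase the length of a triple.
* If `x` drops, then `x + s ≤ (3n+2)(i-1)` because the offsets are at most `3n+2`. Conversely, as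
  `r` is large, this bound puts `x + s` into `A_{i-1}`, since for large `j` the sumset `A_j`
  contains every element of the semigroup `⟨3, 3n+1, 3n+2⟩` up to `(3n+2) j`. Below the bound, the
  `x` that occur are the multiples of `3` and all numbers from `3n+1` on.
-/

namespace BackelinCurve

section DegRevLex

variable {m : ℕ} {d e : Fin m →₀ ℕ}

/-- An order embedding of the degree reverse lexicographic order into a lexicographic product of
linear orders of Mathlib: compare degrees first, then reverse the colexicographic order. -/
noncomputable def degRevLexKey (d : Fin m →₀ ℕ) : ℕ ×ₗ (Colex (Fin m → ℕ))ᵒᵈ :=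
  toLex (d.degree, OrderDual.toDual (toColex ⇑d))

theorem degRevLexKey_injective : Function.Injective (degRevLexKey (m := m)) := fun _ _ h =>
  DFunLike.coe_injective (congrArg (fun x => ofColex (OrderDual.ofDual (ofLex x).2)) h)

theorem degRevLexLT_iff_key_lt : DegRevLexLT d e ↔ degRevLexKey d < degRevLexKey e := by
  rw [degRevLexKey, degRevLexKey, Prod.Lex.toLex_lt_toLex, OrderDual.toDual_lt_toDual]
  refine or_congr Iff.rfl (and_congr Iff.rfl (exists_congr fun i => and_comm.trans ?_))
  exact and_congr (forall₂_congr fun j _ => eq_comm) Iff.rfl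

theorem DegRevLexLT.degree_le (h : DegRevLexLT d e) : d.degree ≤ e.degree :=
  h.elim le_of_lt fun h => h.1.le

theorem DegRevLexLT.add_right (h : DegRevLexLT d e) (c : Fin m →₀ ℕ) :
    DegRevLexLT (d + c) (e + c) := by
  rcases h with h | ⟨h, i, hi, hij⟩
  · exact Or.inl (by simpa using h)
  · exact Or.inr ⟨by simpa using h, i, by simpa using hi, fun j hj => by simpa using hij j hj⟩

theorem wellFounded_degRevLexLT : WellFounded (DegRevLexLT (m := m)) := by
  rw [WellFounded.wellFounded_iff_has_min]
  rintro s ⟨d, hd⟩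
  have hfin : {e ∈ s | e.degree ≤ d.degree}.Finite :=
    (Finsupp.finite_of_degree_le d.degree).subset fun _ he => he.2
  obtain ⟨e, ⟨hes, hed⟩, hmin⟩ := hfin.exists_minimalFor degRevLexKey _ ⟨d, hd, le_rfl⟩
  refine ⟨e, hes, fun c hc hlt => ?_⟩
  have hkey := degRevLexLT_iff_key_lt.mp hlt
  exact hkey.not_ge (hmin ⟨hc, hlt.degree_le.trans hed⟩ hkey.le)

end DegRevLex

section InitialIdeal

variable {k : Type*} [Field k] {m : ℕ} {I : Ideal (MvPolynomial (Fin m) k)}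
  {f : MvPolynomial (Fin m) k} {d : Fin m →₀ ℕ}

theorem exists_isLeadingExponent (hf : f ≠ 0) : ∃ d, IsLeadingExponent f d := by
  obtain ⟨d, hd, hmax⟩ :=
    f.support.exists_max_image degRevLexKey (MvPolynomial.support_nonempty.mpr hf)
  exact ⟨d, hd, fun e he hne => degRevLexLT_iff_key_lt.mpr <|
    lt_of_le_of_ne (hmax e he) (degRevLexKey_injective.ne hne)⟩

theorem IsLeadingExponent.mul_monomial (h : IsLeadingExponent f d) (c : Fin m →₀ ℕ) :
    IsLeadingExponent (f * MvPolynomial.monomial c 1) (d + c) := by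
  have hsupp : (f * MvPolynomial.monomial c 1).support = f.support.map (addRightEmbedding c) :=
    AddMonoidAlgebra.support_coeff_mul_single f 1 (by simp) c
  rw [IsLeadingExponent, hsupp]
  refine ⟨Finset.mem_map_of_mem _ h.1, fun e he hne => ?_⟩
  obtain ⟨e, he', rfl⟩ := Finset.mem_map.mp he
  exact (h.2 e he' (ne_of_apply_ne _ hne)).add_right c

/-- The exponents of the leading monomials of the elements of `I`; the monomials with the other
exponents are the standard monomials of `I`. -/
def leadingExponents (I : Ideal (MvPolynomial (Fin m) k)) : Set (Fin m →₀ ℕ) :=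
  {d | ∃ f ∈ I, IsLeadingExponent f d}

theorem isUpperSet_leadingExponents (I : Ideal (MvPolynomial (Fin m) k)) :
    IsUpperSet (leadingExponents I) := by
  rintro d e hde ⟨f, hf, hd⟩
  obtain ⟨c, rfl⟩ := exists_add_of_le hde
  exact ⟨_, I.mul_mem_right _ hf, hd.mul_monomial c⟩

theorem mem_initialIdeal_iff :
    f ∈ initialIdeal I ↔ f ∈ MvPolynomial.restrictSupport k (leadingExponents I) := by
  have hspan : initialIdeal I =
      Ideal.span ((fun d => MvPolynomial.monomial d (1 : k)) '' leadingExponents I) := by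
    refine congrArg Ideal.span (Set.ext fun g => ?_)
    exact ⟨fun ⟨f, hf, d, hd, hg⟩ => ⟨d, ⟨f, hf, hd⟩, hg.symm⟩,
      fun ⟨d, ⟨f, hf, hd⟩, hg⟩ => ⟨f, hf, d, hd, hg.symm⟩⟩
  rw [hspan, MvPolynomial.mem_ideal_span_monomial_image, MvPolynomial.mem_restrictSupport_iff]
  exact forall₂_congr fun d _ =>
    ⟨fun ⟨e, he, hle⟩ => isUpperSet_leadingExponents I hle he, fun h => ⟨d, h, le_rfl⟩⟩

theorem eq_zero_of_mem_of_mem_restrictSupport_compl (hf : f ∈ I)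
    (hsupp : f ∈ MvPolynomial.restrictSupport k (leadingExponents I)ᶜ) : f = 0 := by
  by_contra hne
  obtain ⟨d, hd⟩ := exists_isLeadingExponent hne
  exact (MvPolynomial.mem_restrictSupport_iff k).mp hsupp hd.1 ⟨f, hf, hd⟩

end InitialIdeal

section Macaulay

variable {k : Type*} [Field k] {m : ℕ} {I : Ideal (MvPolynomial (Fin m) k)} {B D : Set (Fin m →₀ ℕ)}

theorem imageSpan_eq_span (I : Ideal (MvPolynomial (Fin m) k)) (D : Set (Fin m →₀ ℕ)) :
    imageSpan I D =
      Submodule.span k ((fun d => Ideal.Quotient.mkₐ k I (MvPolynomial.monomial d 1)) '' D) := by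
  rw [imageSpan, MvPolynomial.restrictSupport_eq_span, Submodule.map_span, Set.image_image]
  rfl

theorem imageSpan_mono (h : B ⊆ D) : imageSpan I B ≤ imageSpan I D :=
  Submodule.map_mono (MvPolynomial.restrictSupport_mono k h)

theorem mkₐ_monomial_mem_imageSpan (I : Ideal (MvPolynomial (Fin m) k)) {d : Fin m →₀ ℕ}
    (hd : d ∈ D) : Ideal.Quotient.mkₐ k I (MvPolynomial.monomial d 1) ∈ imageSpan I D :=
  Submodule.mem_map_of_mem ((MvPolynomial.monomial_mem_restrictSupport k).mpr (Or.inl hd))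

theorem imageSpan_eq_of_subset (hBD : B ⊆ D)
    (h : ∀ d ∈ D, Ideal.Quotient.mkₐ k I (MvPolynomial.monomial d 1) ∈ imageSpan I B) :
    imageSpan I D = imageSpan I B := by
  refine le_antisymm ?_ (imageSpan_mono hBD)
  rw [imageSpan_eq_span, Submodule.span_le]
  rintro _ ⟨d, hd, rfl⟩
  exact h d hd

theorem finrank_imageSpan_eq_ncard
    (h : ∀ f ∈ I, f ∈ MvPolynomial.restrictSupport k B → f = 0) :
    Module.finrank k (imageSpan I B) = B.ncard := by
  have hinj : Function.Injective
      ((Ideal.Quotient.mkₐ k I).toLinearMap.domRestrict (MvPolynomial.restrictSupport k B)) := by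
    rw [← LinearMap.ker_eq_bot, LinearMap.ker_eq_bot']
    rintro ⟨f, hf⟩ hf0
    exact Subtype.ext (h f (Ideal.Quotient.eq_zero_iff_mem.mp hf0) hf)
  rw [imageSpan, ← LinearMap.range_domRestrict, LinearMap.finrank_range_of_inj hinj,
    Module.finrank_eq_nat_card_basis (MvPolynomial.basisRestrictSupport k B), Set.ncard_def,
    Nat.card, Set.encard]
  rfl

theorem finrank_imageSpan_initialIdeal (I : Ideal (MvPolynomial (Fin m) k))
    (D : Set (Fin m →₀ ℕ)) :
    Module.finrank k (imageSpan (initialIdeal I) D) = (D \ leadingExponents I).ncard := by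
  rw [imageSpan_eq_of_subset Set.sdiff_subset fun d hd => ?_, finrank_imageSpan_eq_ncard]
  · intro f hf hfD
    rw [mem_initialIdeal_iff, MvPolynomial.mem_restrictSupport_iff] at hf
    rw [MvPolynomial.mem_restrictSupport_iff] at hfD
    rw [← MvPolynomial.support_eq_empty, Finset.eq_empty_iff_forall_notMem]
    exact fun d hd => (hfD hd).2 (hf hd)
  · by_cases hdI : d ∈ leadingExponents I
    · have hmem : MvPolynomial.monomial d (1 : k) ∈ initialIdeal I :=
        mem_initialIdeal_iff.mpr ((MvPolynomial.monomial_mem_restrictSupport k).mpr (Or.inl hdI))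
      rw [Ideal.Quotient.mkₐ_eq_mk, Ideal.Quotient.eq_zero_iff_mem.mpr hmem]
      exact zero_mem _
    · exact mkₐ_monomial_mem_imageSpan _ ⟨hd, hdI⟩

/-- A standard expression of `x^d` modulo `I` uses only monomials that are at most `x^d`. -/
theorem mkₐ_monomial_mem_imageSpan_sdiff (hD : ∀ e ∈ D, ∀ d, DegRevLexLT d e → d ∈ D)
    {d : Fin m →₀ ℕ} (hd : d ∈ D) :
    Ideal.Quotient.mkₐ k I (MvPolynomial.monomial d 1) ∈
      imageSpan I (D \ leadingExponents I) := by
  induction d using wellFounded_degRevLexLT.induction with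
  | _ d ih =>
  by_cases hdI : d ∈ leadingExponents I
  · obtain ⟨f, hf, hdf, hlead⟩ := hdI
    have hsum : ∑ e ∈ f.support,
        f.coeff e • Ideal.Quotient.mkₐ k I (MvPolynomial.monomial e 1) = 0 := by
      have hmk := congrArg (Ideal.Quotient.mkₐ k I) f.as_sum
      rw [Ideal.Quotient.mkₐ_eq_mk, Ideal.Quotient.eq_zero_iff_mem.mpr hf, map_sum] at hmk
      rw [hmk]
      refine Finset.sum_congr rfl fun e _ => ?_
      rw [← map_smul, MvPolynomial.smul_monomial, smul_eq_mul, mul_one]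
      rfl
    rw [← Finset.add_sum_erase _ _ hdf, add_eq_zero_iff_eq_neg] at hsum
    rw [← Submodule.smul_mem_iff _ (MvPolynomial.mem_support_iff.mp hdf), hsum]
    refine neg_mem (Submodule.sum_mem _ fun e he => Submodule.smul_mem _ _ ?_)
    have hlt := hlead e (Finset.mem_of_mem_erase he) (Finset.ne_of_mem_erase he)
    exact ih e hlt (hD d hd e hlt)
  · exact mkₐ_monomial_mem_imageSpan _ ⟨hd, hdI⟩

theorem finrank_imageSpan_eq_ncard_sdiff (I : Ideal (MvPolynomial (Fin m) k))
    (hD : ∀ e ∈ D, ∀ d, DegRevLexLT d e → d ∈ D) :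
    Module.finrank k (imageSpan I D) = (D \ leadingExponents I).ncard := by
  rw [imageSpan_eq_of_subset Set.sdiff_subset fun d hd => mkₐ_monomial_mem_imageSpan_sdiff hD hd,
    finrank_imageSpan_eq_ncard]
  exact fun f hf hfD => eq_zero_of_mem_of_mem_restrictSupport_compl hf
    (MvPolynomial.restrictSupport_mono k (fun _ hd => hd.2) hfD)

theorem hilbertFunction_add_finrank (I : Ideal (MvPolynomial (Fin m) k)) (i : ℕ) :
    hilbertFunction I i + Module.finrank k (imageSpan I {d | d.degree < i}) =
      Module.finrank k (imageSpan I {d | d.degree ≤ i}) := by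
  have hle : imageSpan I {d | d.degree < i} ≤ imageSpan I {d | d.degree ≤ i} :=
    imageSpan_mono fun _ hd => show _ ≤ i from le_of_lt hd
  have : Module.Finite k (imageSpan I {d | d.degree ≤ i}) := by
    rw [imageSpan_eq_span]
    exact Module.Finite.span_of_finite k ((Finsupp.finite_of_degree_le i).image _)
  rw [hilbertFunction, ← (Submodule.submoduleOfEquivOfLe hle).finrank_eq,
    Submodule.finrank_quotient_add_finrank]

theorem gradedHilbertFunction_eq_finrank (J : Ideal (MvPolynomial (Fin m) k)) (i : ℕ) :
    gradedHilbertFunction J i = Module.finrank k (imageSpan J {d | d.degree = i}) := by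
  rw [gradedHilbertFunction, MvPolynomial.homogeneousSubmodule_eq_finsupp_supported]
  rfl

theorem gradedHilbertFunction_initialIdeal (I : Ideal (MvPolynomial (Fin m) k)) :
    gradedHilbertFunction (initialIdeal I) = hilbertFunction I := by
  ext i
  have hle := finrank_imageSpan_eq_ncard_sdiff (D := {d | d.degree ≤ i}) I
    fun e he d hlt => hlt.degree_le.trans he
  have hlt := finrank_imageSpan_eq_ncard_sdiff (D := {d | d.degree < i}) I
    fun e he d hlt => hlt.degree_le.trans_lt he
  have hsplit : {d : Fin m →₀ ℕ | d.degree ≤ i} \ leadingExponents I =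
      {d | d.degree = i} \ leadingExponents I ∪ {d | d.degree < i} \ leadingExponents I := by
    rw [← Set.union_sdiff_distrib]
    exact congrArg (· \ _) (Set.ext fun d => show d.degree ≤ i ↔ _ from le_iff_eq_or_lt)
  have hdisj : Disjoint ({d : Fin m →₀ ℕ | d.degree = i} \ leadingExponents I)
      ({d | d.degree < i} \ leadingExponents I) :=
    Set.disjoint_left.mpr fun d hd hd' => hd'.1.ne hd.1
  have hfin : {d : Fin m →₀ ℕ | d.degree ≤ i}.Finite := Finsupp.finite_of_degree_le i
  have hncard := Set.ncard_union_eq hdisj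
    (hfin.subset fun d hd => show d.degree ≤ i from le_of_eq hd.1)
    (hfin.subset fun d hd => show d.degree ≤ i from le_of_lt hd.1)
  have hhilbert := hilbertFunction_add_finrank I i
  rw [gradedHilbertFunction_eq_finrank, finrank_imageSpan_initialIdeal]
  rw [← hsplit] at hncard
  omega

end Macaulay

section MonomialCurve

variable {k : Type*} [Field k] {m : ℕ}

open Finsupp (weight)

theorem finrank_span_image_of_linearIndependent {R ι M : Type*} [Ring R] [StrongRankCondition R]
    [AddCommGroup M] [Module R M] {v : ι → M} (hv : LinearIndependent R v) (A : Set ι) :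
    Module.finrank R (Submodule.span R (v '' A)) = A.ncard := by
  have := nontrivial_of_invariantBasisNumber R
  rw [← Set.ncard_image_of_injective A hv.injective, Module.finrank,
    rank_span_set (hv.linearIndepOn A).id_image]
  rfl

theorem aeval_X_pow_monomial (a : Fin m → ℕ) (d : Fin m →₀ ℕ) :
    MvPolynomial.aeval (fun i => (Polynomial.X : Polynomial k) ^ a i)
      (MvPolynomial.monomial d (1 : k)) = Polynomial.monomial (weight a d) 1 := by
  rw [MvPolynomial.aeval_monomial, map_one, one_mul, Finsupp.prod_fintype _ _ (by simp),
    Finsupp.weight_eq_sum, Polynomial.monomial_one_right_eq_X_pow]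
  simp only [← pow_mul, Finset.prod_pow_eq_pow_sum, smul_eq_mul, mul_comm]

theorem finrank_imageSpan_monomialCurveIdeal (a : Fin m → ℕ) (D : Set (Fin m →₀ ℕ)) :
    Module.finrank k (imageSpan (monomialCurveIdeal k a) D) = (weight a '' D).ncard := by
  obtain ⟨φ, hφ, hmk⟩ : ∃ φ : (MvPolynomial (Fin m) k ⧸ monomialCurveIdeal k a) →ₐ[k] Polynomial k,
      Function.Injective φ ∧ ∀ f, φ (Ideal.Quotient.mkₐ k _ f) =
        MvPolynomial.aeval (fun i => Polynomial.X ^ a i) f :=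
    ⟨Ideal.kerLiftAlg _, Ideal.kerLiftAlg_injective _, Ideal.kerLiftAlg_mk _⟩
  have himage : (imageSpan (monomialCurveIdeal k a) D).map φ.toLinearMap =
      Submodule.span k (Polynomial.basisMonomials k '' (weight a '' D)) := by
    simp only [imageSpan_eq_span, Submodule.map_span, Set.image_image, AlgHom.toLinearMap_apply,
      hmk, aeval_X_pow_monomial, Polynomial.coe_basisMonomials]
  rw [(Submodule.equivMapOfInjective φ.toLinearMap hφ _).finrank_eq, himage,
    finrank_span_image_of_linearIndependent (Polynomial.basisMonomials k).linearIndependent]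

theorem hilbertFunction_monomialCurveIdeal (a : Fin m → ℕ) (i : ℕ) :
    hilbertFunction (monomialCurveIdeal k a) i =
      (weight a '' {d | d.degree ≤ i} \ weight a '' {d | d.degree < i}).ncard := by
  have hsub : weight a '' {d | d.degree < i} ⊆ weight a '' {d | d.degree ≤ i} :=
    Set.image_mono fun d hd => show d.degree ≤ i from le_of_lt hd
  have hncard := Set.ncard_sdiff_add_ncard_of_subset hsub ((Finsupp.finite_of_degree_le i).image _)
  have hhilbert := hilbertFunction_add_finrank (monomialCurveIdeal k a) i
  rw [finrank_imageSpan_monomialCurveIdeal, finrank_imageSpan_monomialCurveIdeal] at hhilbert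
  omega

/-- The `i`-fold sumset of the range of `τ`, encoded by the multiplicities `d` of the summands. -/
def degreeWeights (τ : Fin m → ℕ) (i : ℕ) : Set ℕ := weight τ '' {d | d.degree = i}

theorem finite_degreeWeights (τ : Fin m → ℕ) (i : ℕ) : (degreeWeights τ i).Finite :=
  ((Finsupp.finite_of_degree_le i).subset fun _ hd => le_of_eq hd).image _

theorem le_mul_of_mem_degreeWeights {τ : Fin m → ℕ} {N i x : ℕ} (hτ : ∀ l, τ l ≤ N)
    (hx : x ∈ degreeWeights τ i) : x ≤ N * i := by
  obtain ⟨d, rfl, rfl⟩ := hx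
  rw [Finsupp.weight_eq_sum, Finsupp.degree_eq_sum, mul_comm, Finset.sum_mul]
  exact Finset.sum_le_sum fun l _ => Nat.mul_le_mul_left _ (hτ l)

theorem weight_const_add (s : ℕ) (τ : Fin m → ℕ) (d : Fin m →₀ ℕ) :
    weight (fun l => s + τ l) d = s * d.degree + weight τ d := by
  simp only [Finsupp.weight_eq_sum, Finsupp.degree_eq_sum, smul_eq_mul, mul_add,
    Finset.sum_add_distrib, Finset.sum_mul, mul_comm s]

/-- The elements `x` of `degreeWeights τ i` for which `s * i + x` is also a weight of lower degree
for the exponents `s + τ l`. -/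
def droppingWeights (s : ℕ) (τ : Fin m → ℕ) (i : ℕ) : Set ℕ :=
  {x ∈ degreeWeights τ i | ∃ j < i, ∃ y ∈ degreeWeights τ j, s * j + y = s * i + x}

theorem add_add_le_of_mem_droppingWeights {s N i x : ℕ} {τ : Fin m → ℕ} (hτ : ∀ l, τ l ≤ N)
    (hx : x ∈ droppingWeights s τ i) : x + s + N ≤ N * i := by
  obtain ⟨-, j, hj, y, hy, hsum⟩ := hx
  obtain ⟨l, rfl⟩ := Nat.exists_eq_add_of_lt hj
  have hle := le_mul_of_mem_degreeWeights hτ hy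
  nlinarith

theorem hilbertFunction_add_ncard_droppingWeights (s : ℕ) (τ : Fin m → ℕ) (i : ℕ) :
    hilbertFunction (monomialCurveIdeal k fun l => s + τ l) i + (droppingWeights s τ i).ncard =
      (degreeWeights τ i).ncard := by
  have himage : weight (fun l => s + τ l) '' {d | d.degree ≤ i} \
      weight (fun l => s + τ l) '' {d | d.degree < i} =
        (s * i + ·) '' (degreeWeights τ i \ droppingWeights s τ i) := by
    ext v
    constructor
    · rintro ⟨⟨d, hd, rfl⟩, hnot⟩
      obtain hd | rfl := (show d.degree ≤ i from hd).lt_or_eq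
      · exact absurd ⟨d, hd, rfl⟩ hnot
      · refine ⟨weight τ d, ⟨⟨d, rfl, rfl⟩, ?_⟩, (weight_const_add s τ d).symm⟩
        rintro ⟨-, j, hj, _, ⟨e, rfl, rfl⟩, he⟩
        exact hnot ⟨e, hj, by rw [weight_const_add, weight_const_add, he]⟩
    · rintro ⟨_, ⟨⟨d, rfl, rfl⟩, hnot⟩, rfl⟩
      refine ⟨⟨d, le_refl d.degree, weight_const_add s τ d⟩, ?_⟩
      rintro ⟨e, he, hw⟩
      exact hnot ⟨⟨d, rfl, rfl⟩, e.degree, he, _, ⟨e, rfl, rfl⟩,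
        (weight_const_add s τ e).symm.trans hw⟩
  rw [hilbertFunction_monomialCurveIdeal, himage,
    Set.ncard_image_of_injective _ (add_right_injective _)]
  exact Set.ncard_sdiff_add_ncard_of_subset (fun _ hx => hx.1) (finite_degreeWeights τ i)

end MonomialCurve

section NormalTriples

variable {n a b c a' b' c' i : ℕ}

/-- The element of the numerical semigroup `⟨3, 3n+1, 3n+2⟩` with coefficients `a`, `b`, `c`. -/
def tripleValue (n a b c : ℕ) : ℕ := 3 * a + (3 * n + 1) * b + (3 * n + 2) * c

/-- The exponent triples of the standard monomials of a Gröbner basis of the curve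
`C(3, 3n+1, 3n+2)`. Every value of a triple is the value of exactly one normal triple, and this
normal triple has the least length `a + b + c`. -/
def IsNormalTriple (n a b c : ℕ) : Prop :=
  (a = 0 ∧ b ≤ 3 * n + 1) ∨ (1 ≤ a ∧ a ≤ n ∧ b ≤ 2 ∧ c + 3 * a ≤ 3 * n) ∨
    (n < a ∧ a ≤ 2 * n ∧ b = 0 ∧ c = 0)

/-- The rewriting rules are, in multiplicative notation, `b^(3n+2) → c^(3n+1)`, `a b^3 → c^3`,
`a^(n-j) c^(3j+1) → b^(3j+2)`, `a^(2n+1) → b c`, `a^(n+1) b → c^2` and `a^(n+1) c → b^2`. -/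
theorem exists_reduction (hn : 1 ≤ n) (h : ¬ IsNormalTriple n a b c) :
    ∃ a' b' c', tripleValue n a' b' c' = tripleValue n a b c ∧ a' + b' + c' ≤ a + b + c ∧
      a' + b' + c' + a' < a + b + c + a := by
  unfold IsNormalTriple at h
  unfold tripleValue
  rcases Nat.eq_zero_or_pos a with rfl | ha
  · obtain ⟨b, rfl⟩ := Nat.exists_eq_add_of_le (show 3 * n + 2 ≤ b by omega)
    exact ⟨0, b, c + (3 * n + 1), by ring, by omega, by omega⟩
  obtain hb | hb := Nat.lt_or_ge 2 b
  · obtain ⟨b, rfl⟩ := Nat.exists_eq_add_of_le (show 3 ≤ b by omega)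
    obtain ⟨a, rfl⟩ := Nat.exists_eq_add_of_le (show 1 ≤ a by omega)
    exact ⟨a, b, c + 3, by ring, by omega, by omega⟩
  obtain han | han := Nat.le_total a n
  · obtain ⟨j, rfl⟩ := Nat.exists_eq_add_of_le han
    obtain ⟨c, rfl⟩ := Nat.exists_eq_add_of_le (show 3 * j + 1 ≤ c by omega)
    exact ⟨0, b + (3 * j + 2), c, by ring, by omega, by omega⟩
  obtain ⟨a, rfl⟩ := Nat.exists_eq_add_of_le han
  obtain hc | hc := Nat.eq_zero_or_pos c
  · obtain ⟨a, rfl⟩ := Nat.exists_eq_add_of_le (show 1 ≤ a by omega)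
    obtain hb | hb := Nat.eq_zero_or_pos b
    · obtain ⟨a, rfl⟩ := Nat.exists_eq_add_of_le (show n ≤ a by omega)
      exact ⟨a, b + 1, c + 1, by ring, by omega, by omega⟩
    · obtain ⟨b, rfl⟩ := Nat.exists_eq_add_of_le (show 1 ≤ b by omega)
      exact ⟨a, b, c + 2, by ring, by omega, by omega⟩
  · obtain ⟨c, rfl⟩ := Nat.exists_eq_add_of_le (show 1 ≤ c by omega)
    exact ⟨a, b + 2, c, by ring, by omega, by omega⟩

theorem exists_isNormalTriple (hn : 1 ≤ n) (a b c : ℕ) :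
    ∃ a' b' c', tripleValue n a' b' c' = tripleValue n a b c ∧ a' + b' + c' ≤ a + b + c ∧
      IsNormalTriple n a' b' c' := by
  by_cases h : IsNormalTriple n a b c
  · exact ⟨a, b, c, rfl, le_rfl, h⟩
  · obtain ⟨a₁, b₁, c₁, hv₁, hle₁, _⟩ := exists_reduction hn h
    obtain ⟨a₂, b₂, c₂, hv₂, hle₂, h₂⟩ := exists_isNormalTriple hn a₁ b₁ c₁
    exact ⟨a₂, b₂, c₂, hv₂.trans hv₁, hle₂.trans hle₁, h₂⟩
termination_by a + b + c + a

theorem tripleValue_zero_add (n b c : ℕ) :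
    tripleValue n 0 b c + b = (3 * n + 2) * (b + c) := by
  rw [tripleValue]
  ring

theorem tripleValue_eq_mul_add (n a b c : ℕ) :
    tripleValue n a b c = (3 * n + 1) * (b + c) + (c + 3 * a) := by
  rw [tripleValue]
  ring

theorem IsNormalTriple.div_mod_of_pos (h : IsNormalTriple n a b c) (ha : 1 ≤ a) :
    (b ≤ 2 ∧ tripleValue n a b c / (3 * n + 1) = b + c ∧
        tripleValue n a b c % (3 * n + 1) = c + 3 * a) ∨
      (n < a ∧ b = 0 ∧ c = 0 ∧ tripleValue n a b c / (3 * n + 1) = 1 ∧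
        tripleValue n a b c % (3 * n + 1) + (3 * n + 1) = 3 * a) := by
  obtain ⟨rfl, -⟩ | ⟨-, -, hb, hc⟩ | ⟨hna, han, rfl, rfl⟩ := h
  · omega
  · obtain ⟨hdiv, hmod⟩ := (Nat.div_mod_unique (Nat.succ_pos (3 * n))).mpr
      ⟨(add_comm _ _).trans (tripleValue_eq_mul_add n a b c).symm, by omega⟩
    exact Or.inl ⟨hb, hdiv, hmod⟩
  · obtain ⟨hdiv, hmod⟩ := (Nat.div_mod_unique (Nat.succ_pos (3 * n))).mpr
      (show 3 * a - (3 * n + 1) + (3 * n + 1) * 1 = tripleValue n a 0 0 ∧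
        3 * a - (3 * n + 1) < 3 * n + 1 by rw [tripleValue]; omega)
    exact Or.inr ⟨hna, rfl, rfl, hdiv, by rw [hmod]; omega⟩

/-- The values of the triples with `a = 0` fill the intervals `[(3n+1)j, (3n+2)j]`, and those of
the normal triples with `1 ≤ a` lie in the gaps between them. -/
theorem tripleValue_zero_ne_of_pos (h : IsNormalTriple n a b c) (ha : 1 ≤ a) :
    tripleValue n 0 b' c' ≠ tripleValue n a b c := by
  intro hv
  have hgap : tripleValue n a b c / (3 * n + 1) < tripleValue n a b c % (3 * n + 1) := by
    have hdm := h.div_mod_of_pos ha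
    omega
  have hdiv : b' + c' ≤ tripleValue n a b c / (3 * n + 1) := by
    rw [Nat.le_div_iff_mul_le (Nat.succ_pos _), ← hv, tripleValue]
    linarith
  have hval := Nat.div_add_mod (tripleValue n a b c) (3 * n + 1)
  have hzero := tripleValue_zero_add n b' c'
  nlinarith

theorem eq_of_tripleValue_zero_eq (hb : b ≤ 3 * n + 1) (hb' : b' ≤ 3 * n + 1)
    (hv : tripleValue n 0 b c = tripleValue n 0 b' c') : b = b' ∧ c = c' := by
  have hsum : b' + (3 * n + 2) * (b + c) = b + (3 * n + 2) * (b' + c') := by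
    rw [← tripleValue_zero_add, ← tripleValue_zero_add, hv]
    ring
  have hmod : b' = b := by
    have := congrArg (· % (3 * n + 2)) hsum
    simpa only [Nat.add_mul_mod_self_left, Nat.mod_eq_of_lt (Nat.lt_succ_of_le hb),
      Nat.mod_eq_of_lt (Nat.lt_succ_of_le hb')] using this
  subst hmod
  exact ⟨rfl, by simpa using hsum⟩

theorem IsNormalTriple.eq_of_tripleValue_eq (h : IsNormalTriple n a b c)
    (h' : IsNormalTriple n a' b' c') (hv : tripleValue n a b c = tripleValue n a' b' c') :
    a = a' ∧ b = b' ∧ c = c' := by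
  rcases Nat.eq_zero_or_pos a with rfl | ha <;> rcases Nat.eq_zero_or_pos a' with rfl | ha'
  · unfold IsNormalTriple at h h'
    exact ⟨rfl, eq_of_tripleValue_zero_eq (by omega) (by omega) hv⟩
  · exact absurd hv (tripleValue_zero_ne_of_pos h' ha')
  · exact absurd hv.symm (tripleValue_zero_ne_of_pos h ha)
  · have hdm := h.div_mod_of_pos ha
    have hdm' := h'.div_mod_of_pos ha'
    rw [hv] at hdm
    omega

theorem IsNormalTriple.add_add_le (h : IsNormalTriple n a b c) (hi : 3 * n ≤ i + 2)
    (hv : tripleValue n a b c ≤ (3 * n + 2) * i) : a + b + c ≤ i := by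
  by_contra! hlt
  obtain ⟨rfl, hb⟩ | ⟨ha, -, hb, hc⟩ | ⟨hna, han, rfl, rfl⟩ := h
  · nlinarith [tripleValue_zero_add n b c]
  · obtain rfl : a = 1 := by omega
    rw [tripleValue] at hv
    nlinarith
  · obtain rfl : n = 1 := by omega
    rw [tripleValue] at hv
    omega

theorem exists_tripleValue_eq_iff {x : ℕ} :
    (∃ a b c, tripleValue n a b c = x) ↔ 3 ∣ x ∨ 3 * n + 1 ≤ x := by
  constructor
  · rintro ⟨a, b, c, rfl⟩
    rw [tripleValue_eq_mul_add]
    obtain hbc | hbc := Nat.eq_zero_or_pos (b + c)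
    · obtain ⟨rfl, rfl⟩ : b = 0 ∧ c = 0 := by omega
      exact Or.inl (by simp)
    · exact Or.inr (by nlinarith)
  · rintro (⟨a, rfl⟩ | hx)
    · exact ⟨a, 0, 0, by simp [tripleValue]⟩
    · obtain hmod | hmod | hmod : x % 3 = 0 ∨ x % 3 = 1 ∨ x % 3 = 2 := by omega
      · exact ⟨x / 3, 0, 0, by rw [tripleValue]; omega⟩
      · exact ⟨(x - (3 * n + 1)) / 3, 1, 0, by rw [tripleValue]; omega⟩
      · exact ⟨(x - (3 * n + 2)) / 3, 0, 1, by rw [tripleValue]; omega⟩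

end NormalTriples

section BackelinWeights

variable {n r i x : ℕ}

/-- The differences of the exponents of the Backelin curves to the smallest exponent. -/
def backelinOffsets (n : ℕ) : Fin 4 → ℕ := ![0, 3, 3 * n + 1, 3 * n + 2]

theorem backelinIdeal_eq (k : Type*) [Field k] (n r : ℕ) :
    backelinIdeal k n r = monomialCurveIdeal k fun l => backelinS n r + backelinOffsets n l := by
  rw [backelinIdeal]
  congr 1
  ext l
  fin_cases l <;> rfl

theorem weight_backelinOffsets (n : ℕ) (d : Fin 4 →₀ ℕ) :
    Finsupp.weight (backelinOffsets n) d = tripleValue n (d 1) (d 2) (d 3) := by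
  simp only [Finsupp.weight_eq_sum, Fin.sum_univ_four, backelinOffsets, tripleValue, smul_eq_mul,
    Matrix.cons_val]
  ring

theorem mem_degreeWeights_backelinOffsets :
    x ∈ degreeWeights (backelinOffsets n) i ↔
      ∃ a b c, a + b + c ≤ i ∧ tripleValue n a b c = x := by
  constructor
  · rintro ⟨d, rfl, rfl⟩
    refine ⟨d 1, d 2, d 3, ?_, (weight_backelinOffsets n d).symm⟩
    rw [Finsupp.degree_eq_sum, Fin.sum_univ_four]
    omega
  · rintro ⟨a, b, c, hle, rfl⟩
    refine ⟨Finsupp.equivFunOnFinite.symm ![i - (a + b + c), a, b, c], ?_, ?_⟩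
    · rw [Set.mem_ofPred_eq, Finsupp.degree_eq_sum, Fin.sum_univ_four]
      simp only [Finsupp.equivFunOnFinite_symm_apply_apply, Matrix.cons_val]
      omega
    · exact weight_backelinOffsets n _

theorem backelinOffsets_le (hn : 1 ≤ n) (l : Fin 4) : backelinOffsets n l ≤ 3 * n + 2 := by
  fin_cases l <;> simp only [backelinOffsets, Fin.reduceFinMk, Matrix.cons_val] <;> omega

theorem mem_degreeWeights_backelinOffsets_iff (hn : 1 ≤ n) (hi : 3 * n ≤ i + 2) :
    x ∈ degreeWeights (backelinOffsets n) i ↔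
      x ≤ (3 * n + 2) * i ∧ (3 ∣ x ∨ 3 * n + 1 ≤ x) := by
  rw [← exists_tripleValue_eq_iff]
  constructor
  · intro hx
    obtain ⟨a, b, c, -, hv⟩ := mem_degreeWeights_backelinOffsets.mp hx
    exact ⟨le_mul_of_mem_degreeWeights (backelinOffsets_le hn) hx, a, b, c, hv⟩
  · rintro ⟨hle, a, b, c, rfl⟩
    obtain ⟨a', b', c', hv, -, h⟩ := exists_isNormalTriple hn a b c
    rw [← hv] at hle ⊢
    exact mem_degreeWeights_backelinOffsets.mpr ⟨a', b', c', h.add_add_le hi hle, rfl⟩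

theorem mem_droppingWeights_backelinOffsets_iff (hn : 1 ≤ n) (hr : 3 * n ≤ r + 3) :
    x ∈ droppingWeights (backelinS n r) (backelinOffsets n) i ↔
      (3 ∣ x ∨ 3 * n + 1 ≤ x) ∧ x + 3 + (3 * n + 2) * (r + 1) ≤ (3 * n + 2) * i := by
  constructor
  · intro hx
    have hle := add_add_le_of_mem_droppingWeights (backelinOffsets_le hn) hx
    obtain ⟨a, b, c, -, hv⟩ := mem_degreeWeights_backelinOffsets.mp hx.1
    refine ⟨exists_tripleValue_eq_iff.mp ⟨a, b, c, hv⟩, ?_⟩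
    rw [backelinS] at hle
    linarith
  · rintro ⟨hx, hle⟩
    have hri : r + 1 < i := Nat.lt_of_mul_lt_mul_left (a := 3 * n + 2) (by omega)
    obtain ⟨j, rfl⟩ : ∃ j, i = j + 1 := Nat.exists_eq_add_one.mpr (Nat.zero_lt_of_lt hri)
    refine ⟨(mem_degreeWeights_backelinOffsets_iff hn (by omega)).mpr ⟨by omega, hx⟩,
      j, j.lt_succ_self, x + backelinS n r, ?_, by ring⟩
    rw [mem_degreeWeights_backelinOffsets_iff hn (by omega), backelinS]
    refine ⟨by linarith, ?_⟩
    obtain rfl | hr0 := Nat.eq_zero_or_pos r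
    · omega
    · exact Or.inr (by nlinarith)

theorem droppingWeights_backelinOffsets_eq_empty (hn : 1 ≤ n) (hr : 3 * n ≤ r + 3)
    (hi : i < r + 2) : droppingWeights (backelinS n r) (backelinOffsets n) i = ∅ := by
  refine Set.eq_empty_of_forall_notMem fun x hx => ?_
  have hle := ((mem_droppingWeights_backelinOffsets_iff hn hr).mp hx).2
  have := Nat.mul_le_mul_left (3 * n + 2) (Nat.lt_succ_iff.mp hi)
  omega

theorem droppingWeights_backelinOffsets_add (hn : 1 ≤ n) (hr : 3 * n ≤ r + 3) (j : ℕ) :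
    droppingWeights (backelinS n r) (backelinOffsets n) (r + 2 + j) =
      ((Finset.range n).image (3 * ·) ∪ Finset.Ico (3 * n) (3 * n + (3 * n + 2) * j) :
        Finset ℕ) := by
  ext x
  have hlt : x + 3 + (3 * n + 2) * (r + 1) ≤ (3 * n + 2) * (r + 2 + j) ↔
      x < 3 * n + (3 * n + 2) * j := by
    rw [show (3 * n + 2) * (r + 2 + j) =
      3 * n + (3 * n + 2) * j + 2 + (3 * n + 2) * (r + 1) by ring]
    omega
  simp only [mem_droppingWeights_backelinOffsets_iff hn hr, hlt, Finset.coe_union,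
    Finset.coe_image, Finset.coe_range, Finset.coe_Ico, Set.mem_union, Set.mem_image,
    Set.mem_Iio, Set.mem_Ico]
  constructor
  · rintro ⟨hx, hxlt⟩
    obtain hxn | hxn := Nat.lt_or_ge x (3 * n)
    · exact Or.inl ⟨x / 3, by omega, by omega⟩
    · exact Or.inr ⟨hxn, hxlt⟩
  · rintro (⟨y, hy, rfl⟩ | ⟨hle, hxlt⟩)
    · exact ⟨Or.inl (dvd_mul_right 3 y), by omega⟩
    · exact ⟨by omega, hxlt⟩

theorem ncard_droppingWeights_backelinOffsets (hn : 1 ≤ n) (hr : 3 * n ≤ r + 3) (j : ℕ) :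
    (droppingWeights (backelinS n r) (backelinOffsets n) (r + 2 + j)).ncard =
      (3 * n + 2) * j + n := by
  have hdisj : Disjoint ((Finset.range n).image (3 * ·))
      (Finset.Ico (3 * n) (3 * n + (3 * n + 2) * j)) := by
    rw [Finset.disjoint_left]
    simp only [Finset.mem_image, Finset.mem_range, Finset.mem_Ico]
    omega
  rw [droppingWeights_backelinOffsets_add hn hr, Set.ncard_coe_finset,
    Finset.card_union_of_disjoint hdisj,
    Finset.card_image_of_injective _ (mul_right_injective₀ three_ne_zero), Finset.card_range,
    Nat.card_Ico]
  omega

end BackelinWeights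

section Counting

variable {n : ℕ}

/-- The normal triples whose first entry lies between `1` and `n`. -/
def smallTriples (n : ℕ) : Finset (ℕ × ℕ × ℕ) :=
  (Finset.Ico 1 (n + 1) ×ˢ Finset.range 3 ×ˢ Finset.range (3 * n + 1)).filter
    fun p => p.2.2 + 3 * p.1 ≤ 3 * n

theorem degreeWeights_backelinOffsets_eq_image (hn : 1 ≤ n) (i : ℕ) :
    degreeWeights (backelinOffsets n) i = (fun p : ℕ × ℕ × ℕ => tripleValue n p.1 p.2.1 p.2.2) ''
      {p | IsNormalTriple n p.1 p.2.1 p.2.2 ∧ p.1 + p.2.1 + p.2.2 ≤ i} := by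
  ext x
  rw [mem_degreeWeights_backelinOffsets]
  constructor
  · rintro ⟨a, b, c, hle, rfl⟩
    obtain ⟨a', b', c', hv, hle', h⟩ := exists_isNormalTriple hn a b c
    exact ⟨(a', b', c'), ⟨h, hle'.trans hle⟩, hv⟩
  · rintro ⟨⟨a, b, c⟩, ⟨-, hle⟩, rfl⟩
    exact ⟨a, b, c, hle, rfl⟩

theorem injOn_tripleValue (n : ℕ) :
    Set.InjOn (fun p : ℕ × ℕ × ℕ => tripleValue n p.1 p.2.1 p.2.2)
      {p | IsNormalTriple n p.1 p.2.1 p.2.2} := by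
  rintro ⟨a, b, c⟩ h ⟨a', b', c'⟩ h' hv
  obtain ⟨rfl, rfl, rfl⟩ := IsNormalTriple.eq_of_tripleValue_eq h h' hv
  rfl

theorem setOf_isNormalTriple_eq (n i : ℕ) :
    {p : ℕ × ℕ × ℕ | IsNormalTriple n p.1 p.2.1 p.2.2 ∧ p.1 + p.2.1 + p.2.2 ≤ i} =
      (((Finset.range (3 * n + 2)).sigma fun b => Finset.range (i + 1 - b)).image
          (fun p => (0, p.1, p.2)) ∪
        ((smallTriples n).filter (fun p => p.1 + p.2.1 + p.2.2 ≤ i) ∪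
          ((Finset.Ico (n + 1) (2 * n + 1)).filter (· ≤ i)).image fun a => (a, 0, 0)) :
        Finset (ℕ × ℕ × ℕ)) := by
  ext ⟨a, b, c⟩
  simp only [smallTriples, IsNormalTriple, Set.mem_ofPred_eq, Finset.mem_coe, Finset.mem_union,
    Finset.mem_image, Finset.mem_filter, Finset.mem_sigma, Finset.mem_product, Finset.mem_range,
    Finset.mem_Ico, Sigma.exists, Prod.mk.injEq]
  constructor
  · rintro ⟨⟨rfl, hb⟩ | h | ⟨hna, han, rfl, rfl⟩, hle⟩
    · exact Or.inl ⟨b, c, by omega, rfl, rfl, rfl⟩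
    · exact Or.inr (Or.inl (by omega))
    · exact Or.inr (Or.inr ⟨a, by omega, rfl, rfl, rfl⟩)
  · rintro (⟨b, c, h, rfl, rfl, rfl⟩ | h | ⟨a, h, rfl, rfl, rfl⟩) <;> omega

theorem ncard_degreeWeights_backelinOffsets (hn : 1 ≤ n) (i : ℕ) :
    (degreeWeights (backelinOffsets n) i).ncard =
      ∑ b ∈ Finset.range (3 * n + 2), (i + 1 - b) +
        (((smallTriples n).filter fun p => p.1 + p.2.1 + p.2.2 ≤ i).card +
          ((Finset.Ico (n + 1) (2 * n + 1)).filter (· ≤ i)).card) := by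
  rw [degreeWeights_backelinOffsets_eq_image hn,
    ((injOn_tripleValue n).mono fun _ hp => hp.1).ncard_image, setOf_isNormalTriple_eq,
    Set.ncard_coe_finset, Finset.card_union_of_disjoint, Finset.card_union_of_disjoint,
    Finset.card_image_of_injective, Finset.card_image_of_injective, Finset.card_sigma]
  · simp only [Finset.card_range]
  · exact fun _ _ h => congrArg Prod.fst h
  · rintro ⟨b, c⟩ ⟨b', c'⟩ h
    simpa using h
  · simp only [Finset.disjoint_left, smallTriples, Finset.mem_image, Finset.mem_filter,
      Finset.mem_product, Finset.mem_Ico, not_exists, not_and]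
    rintro p h a ha rfl
    omega
  · simp only [Finset.disjoint_left, smallTriples, Finset.mem_union, Finset.mem_image,
      Finset.mem_filter, Finset.mem_product, Finset.mem_Ico]
    rintro _ ⟨p, -, rfl⟩ (h | ⟨a, h, ha⟩)
    · omega
    · rw [Prod.mk.injEq] at ha
      omega

end Counting

section GeneratingSeries

open PowerSeries

variable {n : ℕ}

theorem series_add (f g : ℕ → ℕ) : series (fun i => f i + g i) = series f + series g := by
  ext i
  simp [series]

theorem series_finset_sum {ι : Type*} (s : Finset ι) (f : ι → ℕ → ℕ) :
    series (fun i => ∑ b ∈ s, f b i) = ∑ b ∈ s, series (f b) := by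
  ext i
  simp [series]

theorem series_add_one_mul : series (fun i => i + 1) * (1 - X) ^ 2 = 1 := by
  simpa only [series, Nat.choose_one_right, add_comm 1, one_add_one_eq_two]
    using mk_add_choose_mul_one_sub_pow_eq_one ℤ 1

theorem series_add_one_sub_mul (b : ℕ) : series (fun i => i + 1 - b) * (1 - X) ^ 2 = X ^ b := by
  have h : series (fun i => i + 1 - b) = X ^ b * series fun i => i + 1 := by
    ext i
    rw [coeff_X_pow_mul', series, series, coeff_mk]
    split_ifs with hb
    · rw [coeff_mk, Nat.sub_add_comm hb]
    · rw [Nat.sub_eq_zero_of_le (not_le.mp hb), Nat.cast_zero]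
  rw [h, mul_assoc, series_add_one_mul, mul_one]

theorem series_sum_range_mul (N : ℕ) :
    series (fun i => ∑ b ∈ Finset.range N, (i + 1 - b)) * (1 - X) ^ 3 = 1 - X ^ N := by
  rw [series_finset_sum, pow_succ, ← mul_assoc, Finset.sum_mul,
    Finset.sum_congr rfl fun b _ => series_add_one_sub_mul b, geom_sum_mul_neg]

theorem series_card_filter_le_mul {ι : Type*} (s : Finset ι) (l : ι → ℕ) :
    series (fun i => (s.filter fun p => l p ≤ i).card) * (1 - X) = ∑ p ∈ s, X ^ l p := by
  have h : series (fun i => (s.filter fun p => l p ≤ i).card) = (∑ p ∈ s, X ^ l p) * mk 1 := by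
    ext i
    simp [series, Finset.sum_mul, coeff_X_pow_mul']
  rw [h, mul_assoc, mk_one_mul_one_sub_eq_one, mul_one]

theorem sum_smallTriples (n : ℕ) :
    ∑ p ∈ smallTriples n, (X : ℤ⟦X⟧) ^ (p.1 + p.2.1 + p.2.2) =
      (∑ a ∈ Finset.Ico 1 (n + 1), X ^ a * ∑ c ∈ Finset.range (3 * n - 3 * a + 1), X ^ c) *
        (1 + X + X ^ 2) := by
  rw [Finset.sum_finset_product _ (Finset.Ico 1 (n + 1))
    (fun a => Finset.range 3 ×ˢ Finset.range (3 * n - 3 * a + 1)), Finset.sum_mul]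
  · refine Finset.sum_congr rfl fun a _ => ?_
    simp only [Finset.sum_product, pow_add, ← Finset.mul_sum, ← Finset.sum_mul]
    rw [Finset.sum_range_succ _ 2, Finset.sum_range_succ _ 1, Finset.sum_range_one]
    ring
  · rintro ⟨a, b, c⟩
    simp only [smallTriples, Finset.mem_filter, Finset.mem_product, Finset.mem_range,
      Finset.mem_Ico]
    omega

/-- The sum of the powers `t ^ (n + 2 i - 1)` over `1 ≤ i ≤ n`, whose second difference appears in
the numerator of the Hilbert series; it is indexed from `0` here. -/
noncomputable def oddSum (n : ℕ) : ℤ⟦X⟧ := ∑ i ∈ Finset.range n, X ^ (n + 2 * i + 1)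

theorem oddSum_mul (n : ℕ) : oddSum n * (1 - X ^ 2) = X ^ (n + 1) - X ^ (3 * n + 1) := by
  have h : oddSum n = X ^ (n + 1) * ∑ i ∈ Finset.range n, (X ^ 2) ^ i := by
    rw [oddSum, Finset.mul_sum]
    exact Finset.sum_congr rfl fun i _ => by ring
  rw [h, mul_assoc, geom_sum_mul_neg]
  ring

theorem sum_Ico_X_pow_eq_oddSum (n : ℕ) :
    ∑ a ∈ Finset.Ico 1 (n + 1), (X : ℤ⟦X⟧) ^ (3 * n + 1 - 2 * a) = oddSum n := by
  rw [oddSum, ← Finset.sum_range_reflect, Finset.sum_Ico_eq_sum_range, Nat.add_sub_cancel]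
  refine Finset.sum_congr rfl fun i hi => ?_
  rw [Finset.mem_range] at hi
  congr 1
  omega

theorem sum_smallTriples_mul (n : ℕ) :
    (∑ p ∈ smallTriples n, (X : ℤ⟦X⟧) ^ (p.1 + p.2.1 + p.2.2)) * (1 - X) ^ 3 =
      (X - X ^ (n + 1)) * (1 - X ^ 3) - oddSum n * (1 - X) * (1 - X ^ 3) := by
  have hinner : (∑ a ∈ Finset.Ico 1 (n + 1),
      (X : ℤ⟦X⟧) ^ a * ∑ c ∈ Finset.range (3 * n - 3 * a + 1), X ^ c) * (1 - X) =
        ∑ a ∈ Finset.Ico 1 (n + 1), X ^ a - oddSum n := by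
    rw [← sum_Ico_X_pow_eq_oddSum, ← Finset.sum_sub_distrib, Finset.sum_mul]
    refine Finset.sum_congr rfl fun a ha => ?_
    rw [Finset.mem_Ico] at ha
    rw [mul_assoc, geom_sum_mul_neg, mul_sub, mul_one, ← pow_add]
    congr 2
    omega
  have houter := geom_sum_Ico_mul_neg (X : ℤ⟦X⟧) (show 1 ≤ n + 1 by omega)
  rw [sum_smallTriples]
  linear_combination (1 - X) ^ 2 * (1 + X + X ^ 2) * hinner + (1 - X ^ 3) * houter

theorem series_ncard_degreeWeights_mul (hn : 1 ≤ n) :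
    series (fun i => (degreeWeights (backelinOffsets n) i).ncard) * (1 - X) ^ 4 =
      1 - X ^ (2 * n + 1) * (1 - X) ^ 2 + X ^ (n + 4) + X ^ (n + 3) - X ^ (n + 2) - X ^ (n + 1)
        - X ^ 4 - (oddSum n - X ^ (n + 1)) * (1 - X) ^ 2 := by
  simp_rw [ncard_degreeWeights_backelinOffsets hn, series_add]
  have hzero := series_sum_range_mul (3 * n + 2)
  have hsmall := series_card_filter_le_mul (smallTriples n) fun p => p.1 + p.2.1 + p.2.2
  have hlarge := series_card_filter_le_mul (Finset.Ico (n + 1) (2 * n + 1)) fun a => a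
  have hlarge' := geom_sum_Ico_mul_neg (X : ℤ⟦X⟧) (show n + 1 ≤ 2 * n + 1 by omega)
  linear_combination (1 - X) * hzero + (1 - X) ^ 3 * hsmall + (1 - X) ^ 3 * hlarge
    + sum_smallTriples_mul n + (1 - X) ^ 2 * hlarge' - X * (1 - X) * oddSum_mul n

theorem series_ncard_droppingWeights_mul {r : ℕ} (hn : 1 ≤ n) (hr : 3 * n ≤ r + 3) :
    series (fun i => (droppingWeights (backelinS n r) (backelinOffsets n) i).ncard) *
        (1 - X) ^ 4 =
      X ^ (r + 2) * ((n : ℤ⟦X⟧) + (2 * (n : ℤ⟦X⟧) + 2) * X) * (1 - X) ^ 2 := by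
  have h : series (fun i => (droppingWeights (backelinS n r) (backelinOffsets n) i).ncard) =
      X ^ (r + 2) * (C (3 * n + 2 : ℤ) * series (fun i => i + 1) - C (2 * n + 2 : ℤ) * mk 1) := by
    ext i
    rw [series, coeff_mk, coeff_X_pow_mul']
    split_ifs with hi
    · obtain ⟨j, rfl⟩ := Nat.exists_eq_add_of_le hi
      rw [ncard_droppingWeights_backelinOffsets hn hr, Nat.add_sub_cancel_left, map_sub,
        coeff_C_mul, coeff_C_mul, series, coeff_mk, coeff_mk]
      push_cast
      simp only [Pi.one_apply]
      ring
    · rw [droppingWeights_backelinOffsets_eq_empty hn hr (not_le.mp hi), Set.ncard_empty,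
        Nat.cast_zero]
  rw [h]
  simp only [map_add, map_mul, map_natCast, map_ofNat]
  linear_combination X ^ (r + 2) * (1 - X) ^ 2 * (3 * n + 2) * series_add_one_mul
    - X ^ (r + 2) * (1 - X) ^ 3 * (2 * n + 2) * mk_one_mul_one_sub_eq_one ℤ

theorem sum_Icc_eq_oddSum_sub_mul (hn : 1 ≤ n) :
    ∑ i ∈ Finset.Icc 2 n,
        ((X : ℤ⟦X⟧) ^ (n + 2 * i - 1) + X ^ (n + 2 * i + 1) - 2 * X ^ (n + 2 * i)) =
      (oddSum n - X ^ (n + 1)) * (1 - X) ^ 2 := by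
  obtain ⟨l, rfl⟩ := Nat.exists_eq_add_of_le' hn
  have hfirst : oddSum (l + 1) - X ^ (l + 1 + 1) =
      ∑ i ∈ Finset.range l, X ^ (l + 1 + 2 * (i + 1) + 1) := by
    rw [oddSum, Finset.sum_range_succ', mul_zero, add_zero, add_sub_cancel_right]
  rw [hfirst, ← Finset.Ico_add_one_right_eq_Icc, Finset.sum_Ico_eq_sum_range, Finset.sum_mul,
    show l + 1 + 1 - 2 = l from rfl]
  refine Finset.sum_congr rfl fun i _ => ?_
  rw [show l + 1 + 2 * (2 + i) - 1 = l + 1 + 2 * (i + 1) + 1 by omega]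
  ring

theorem coe_backelinNumerator (hn : 1 ≤ n) (r : ℕ) :
    (backelinNumerator n r : ℤ⟦X⟧) =
      1 - X ^ (2 * n + 1) * (1 - X) ^ 2 + X ^ (n + 4) + X ^ (n + 3) - X ^ (n + 2) - X ^ (n + 1)
        - X ^ 4 - (oddSum n - X ^ (n + 1)) * (1 - X) ^ 2
        - X ^ (r + 2) * ((n : ℤ⟦X⟧) + (2 * (n : ℤ⟦X⟧) + 2) * X) * (1 - X) ^ 2 := by
  rw [← sum_Icc_eq_oddSum_sub_mul hn, backelinNumerator,
    ← Polynomial.coeToPowerSeries.ringHom_apply]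
  simp only [map_sub, map_add, map_mul, map_pow, map_sum, map_one, map_natCast, map_ofNat,
    Polynomial.coeToPowerSeries.ringHom_apply, Polynomial.coe_X]
  ring

theorem series_hilbertFunction_backelinIdeal_mul (k : Type*) [Field k] {r : ℕ} (hn : 1 ≤ n)
    (hr : 3 * n ≤ r + 3) :
    series (hilbertFunction (backelinIdeal k n r)) * (1 - X) ^ 4 =
      (backelinNumerator n r : ℤ⟦X⟧) := by
  have hadd := congrArg series <| funext <|
    hilbertFunction_add_ncard_droppingWeights (k := k) (backelinS n r) (backelinOffsets n)
  rw [series_add, ← backelinIdeal_eq] at hadd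
  rw [coe_backelinNumerator hn, ← series_ncard_degreeWeights_mul hn,
    ← series_ncard_droppingWeights_mul hn hr]
  linear_combination (1 - X) ^ 4 * hadd

end GeneratingSeries

end BackelinCurve

theorem mainTheorem7_general (k : Type*) [Field k] (n r : ℕ) (hn : 1 ≤ n) (hr : 3 * n ≤ r + 3) :
    BackelinCurve.series
        (BackelinCurve.hilbertFunction (BackelinCurve.backelinIdeal k n r)) *
        (1 - PowerSeries.X) ^ 4 =
      (BackelinCurve.backelinNumerator n r : PowerSeries ℤ) ∧
    BackelinCurve.series
        (BackelinCurve.gradedHilbertFunction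
          (BackelinCurve.initialIdeal (BackelinCurve.backelinIdeal k n r))) *
        (1 - PowerSeries.X) ^ 4 =
      (BackelinCurve.backelinNumerator n r : PowerSeries ℤ) := by
  rw [BackelinCurve.gradedHilbertFunction_initialIdeal, and_self]
  exact BackelinCurve.series_hilbertFunction_backelinIdeal_mul k hn hr

theorem mainTheorem7 (k : Type*) [Field k] (n r : ℕ) (hn : 2 ≤ n) (hr : 3 * n + 2 ≤ r) :
    BackelinCurve.series
        (BackelinCurve.hilbertFunction (BackelinCurve.backelinIdeal k n r)) *
        (1 - PowerSeries.X) ^ 4 =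
      (BackelinCurve.backelinNumerator n r : PowerSeries ℤ) ∧
    BackelinCurve.series
        (BackelinCurve.gradedHilbertFunction
          (BackelinCurve.initialIdeal (BackelinCurve.backelinIdeal k n r))) *
        (1 - PowerSeries.X) ^ 4 =
      (BackelinCurve.backelinNumerator n r : PowerSeries ℤ) :=
  mainTheorem7_general k n r (by omega) (by omega)
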